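/- Let $\mathbf{W}^*$ be the category whose objects are the Archimedean real vector lattices $A$ with a distinguished strong unit $u_A$ (that is, $u_A \ge 0$ and every $a \in A$ satisfies $|a| \le n u_A$ for some $n \in \mathbb{N}$; the zero vector lattice with $u_A = 0$ is allowed) and whose morphisms are the unit-preserving vector lattice homomorphisms. The Yosida space $YA$ is the set of ideals (solid linear subspaces) of $A$ that are maximal with respect to not containing $u_A$, with the hull-kernel topology. The Yosida embedding $\nu_A \colon A \to C(YA)$ sends $a$ to the continuous function whose value at $M \in YA$ is the unique real $r$ with $a - r u_A \in M$. An injective morphism $f \colon A \to B$ is an essential embedding if every morphism $g \colon B \to C$ in $\mathbf{W}^*$ with $g \circ f$ injective is itself injective. Let $K$ be a compact Hausdorff space. Consider the objects $A \in \mathbf{W}^*$ with $YA = K$, that is, equipped with an identification (homeomorphism) of $YA$ with $K$, so that $\nu_A$ is regarded as a map $A \to C(K)$. Write $A \le B$ if there is an essential embedding $f \colon A \to B$ with $\nu_A = \nu_B \circ f$. This is a preorder; identifying $A$ with $B$ when $A \le B \le A$ gives the poset $\{A \in \mathbf{W}^* : YA = K\}$. **Theorem.** The poset $\{A \in \mathbf{W}^*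 : YA = K\}$ has a minimum if and only if $K$ is zero-dimensional (its clopen sets form a base). In that case the minimum is $$F(K) = \{ f \in C(K) : f(K) \text{ is finite} \},$$ with the constant function $1$ as unit and with $YF(K)$ identified with $K$ in such a way that $\nu_{F(K)}$ is the inclusion $F(K) \subseteq C(K)$. -/

import Mathlib

universe u

namespace YosidaMin

/-- An object of the category `W*`: an Archimedean real vector lattice with a distinguished strong
order unit (for the zero vector lattice the unit is `0`). -/
structure WStar where
  /-- the underlying type -/
  carrier : Type u
  [addCommGroup : AddCommGroup carrier]
  [lattice : Lattice carrier]
  [isOrderedAddMonoid : IsOrderedAddMonoid carrier]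
  [module : Module ℝ carrier]
  [isOrderedModule : IsOrderedModule ℝ carrier]
  archimedean : ∀ a b : carrier, (∀ n : ℕ, n • a ≤ b) → a ≤ 0
  /-- the distinguished strong unit -/
  unit : carrier
  unit_nonneg : 0 ≤ unit
  exists_abs_le : ∀ a : carrier, ∃ n : ℕ, |a| ≤ n • unit

namespace WStar

instance : CoeSort WStar.{u} (Type u) := ⟨WStar.carrier⟩

attribute [instance] WStar.addCommGroup WStar.lattice WStar.isOrderedAddMonoid
  WStar.module WStar.isOrderedModule

/-- The morphisms of `W*`: unit-preserving vector lattice homomorphisms. -/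
structure Hom (A B : WStar.{u}) extends A.carrier →ₗ[ℝ] B.carrier where
  map_sup : ∀ a b : A, toFun (a ⊔ b) = toFun a ⊔ toFun b
  map_inf : ∀ a b : A, toFun (a ⊓ b) = toFun a ⊓ toFun b
  map_unit : toFun A.unit = B.unit

instance (A B : WStar.{u}) : CoeFun (Hom A B) (fun _ => A → B) := ⟨fun f => f.toFun⟩

/-- The identity morphism. -/
def Hom.id (A : WStar.{u}) : Hom A A where
  toLinearMap := LinearMap.id
  map_sup _ _ := rfl
  map_inf _ _ := rfl
  map_unit := rfl

/-- Composition of morphisms. -/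
def Hom.comp {A B C : WStar.{u}} (g : Hom B C) (f : Hom A B) : Hom A C where
  toLinearMap := g.toLinearMap.comp f.toLinearMap
  map_sup a b := (congrArg g (f.map_sup a b)).trans (g.map_sup _ _)
  map_inf a b := (congrArg g (f.map_inf a b)).trans (g.map_inf _ _)
  map_unit := (congrArg g f.map_unit).trans g.map_unit

/-- Essential embeddings: embeddings `f : A → B` such that every morphism `g` out of `B` with
`g ∘ f` monic (that is, injective) is itself monic. -/
def IsEssentialEmbedding {A B : WStar.{u}} (f : Hom A B) : Prop :=
  Function.Injective f ∧
    ∀ (C : WStar.{u}) (g : Hom B C), Function.Injective (fun a => g (f a)) → Function.Injective g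

/-- Ideals of a vector lattice: the solid linear subspaces. -/
def IsIdeal (A : WStar.{u}) (I : Submodule ℝ A) : Prop :=
  ∀ x ∈ I, ∀ y : A, |y| ≤ |x| → y ∈ I

/-- The Yosida space `YA` as a set: the ideals that are maximal with respect to not containing the
distinguished unit. -/
def Yosida (A : WStar.{u}) : Type u :=
  {M : Submodule ℝ A // Maximal (fun I => A.IsIdeal I ∧ A.unit ∉ I) M}

/-- The ideal of `A` that is a given point of `YA`. -/
def Yosida.ideal {A : WStar.{u}} (M : Yosida A) : Submodule ℝ A := M.1

/-- The hull-kernel topology on `YA`: the sets `{M | a ∉ M}`, which are the complements of the hulls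
`{M | a ∈ M}`, are a base of the open sets. -/
instance (A : WStar.{u}) : TopologicalSpace (Yosida A) :=
  TopologicalSpace.generateFrom (Set.range fun a : A => {M : Yosida A | a ∉ M.ideal})

section PointEvaluation

variable {A : WStar.{u}} (M : Yosida A)

theorem Yosida.solid {x y : A} (hx : x ∈ M.ideal) (h : |y| ≤ |x|) : y ∈ M.ideal :=
  M.2.prop.1 x hx y h

theorem Yosida.of_le {x y : A} (hx : x ∈ M.ideal) (h0 : 0 ≤ y) (h : y ≤ x) : y ∈ M.ideal :=
  M.solid hx (by rwa [abs_of_nonneg h0, abs_of_nonneg (h0.trans h)])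

theorem Yosida.abs_mem {x : A} (hx : x ∈ M.ideal) : |x| ∈ M.ideal :=
  M.solid hx (by rw [abs_abs])

theorem Yosida.sup_zero_mem {x : A} (hx : x ∈ M.ideal) : x ⊔ 0 ∈ M.ideal :=
  M.of_le (M.abs_mem hx) le_sup_right (sup_le (le_abs_self x) (abs_nonneg x))

theorem Yosida.unit_notMem : A.unit ∉ M.ideal := M.2.prop.2

theorem Yosida.not_smul_unit_le {c : ℝ} (hc : 0 < c) {m : A} (hm : m ∈ M.ideal)
    (h : c • A.unit ≤ m) : False := by
  have h1 : c • A.unit ∈ M.ideal := M.of_le hm (smul_nonneg hc.le A.unit_nonneg) h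
  have h2 := M.ideal.smul_mem c⁻¹ h1
  rw [smul_smul, inv_mul_cancel₀ hc.ne', one_smul] at h2
  exact M.unit_notMem h2

theorem abs_smul_le (c : ℝ) (x : A) : |c • x| ≤ |c| • |x| := by
  have h1 : ∀ d : ℝ, 0 ≤ d → |d • x| ≤ d • |x| := fun d hd => by
    refine abs_le'.2 ⟨smul_le_smul_of_nonneg_left (le_abs_self x) hd, ?_⟩
    rw [← smul_neg]
    exact smul_le_smul_of_nonneg_left (neg_le_abs x) hd
  rcases le_total 0 c with hc | hc
  · rw [abs_of_nonneg hc]; exact h1 c hc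
  · rw [abs_of_nonpos hc, ← abs_neg, ← neg_smul]; exact h1 (-c) (by linarith)

theorem Yosida.exists_unit_le {x : A} (hx : x ∉ M.ideal) :
    ∃ m ∈ M.ideal, ∃ c : ℝ, 0 ≤ c ∧ A.unit ≤ m + c • |x| := by
  let J : Submodule ℝ A :=
    { carrier := {y | ∃ m ∈ M.ideal, ∃ c : ℝ, 0 ≤ c ∧ |y| ≤ m + c • |x|}
      zero_mem' := ⟨0, M.ideal.zero_mem, 0, le_rfl, by simp⟩
      add_mem' := by
        rintro y z ⟨m, hm, c, hc, h⟩ ⟨m', hm', c', hc', h'⟩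
        refine ⟨m + m', M.ideal.add_mem hm hm', c + c', add_nonneg hc hc', ?_⟩
        calc |y + z| ≤ |y| + |z| := abs_add_le y z
          _ ≤ (m + c • |x|) + (m' + c' • |x|) := add_le_add h h'
          _ = _ := by rw [add_smul]; abel
      smul_mem' := by
        rintro d y ⟨m, hm, c, hc, h⟩
        refine ⟨|d| • m, M.ideal.smul_mem _ hm, |d| * c, by positivity, ?_⟩
        calc |d • y| ≤ |d| • |y| := abs_smul_le d y
          _ ≤ |d| • (m + c • |x|) := smul_le_smul_of_nonneg_left h (abs_nonneg d)
          _ = _ := by rw [smul_add, smul_smul] }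
  have hJ : A.IsIdeal J := by
    rintro y ⟨m, hm, c, hc, h⟩ z hz
    exact ⟨m, hm, c, hc, hz.trans h⟩
  have hMJ : M.ideal ≤ J := fun y hy => ⟨|y|, M.abs_mem hy, 0, le_rfl, by simp⟩
  have hxJ : x ∈ J := ⟨0, M.ideal.zero_mem, 1, zero_le_one, by simp⟩
  by_contra hcon
  have hu : A.unit ∉ J := by
    rintro ⟨m, hm, c, hc, h⟩
    exact hcon ⟨m, hm, c, hc, (le_abs_self _).trans h⟩
  exact hx (M.2.le_of_ge ⟨hJ, hu⟩ hMJ hxJ)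

theorem Yosida.mem_or_mem_of_inf_eq_zero {x y : A} (hxy : x ⊓ y = 0) :
    x ∈ M.ideal ∨ y ∈ M.ideal := by
  by_contra hcon
  rw [not_or] at hcon
  have hx0 : 0 ≤ x := hxy ▸ inf_le_left
  have hy0 : 0 ≤ y := hxy ▸ inf_le_right
  obtain ⟨m, hm, c, hc, h⟩ := M.exists_unit_le hcon.1
  obtain ⟨m', hm', c', hc', h'⟩ := M.exists_unit_le hcon.2
  rw [abs_of_nonneg hx0] at h
  rw [abs_of_nonneg hy0] at h'
  have hd : 0 < c + c' + 1 := by positivity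
  have e : (c + c' + 1) • x ⊓ (c + c' + 1) • y = 0 := by
    have := (OrderIso.smulRight (β := A) hd).map_inf x y
    simp only [OrderIso.smulRight_apply, hxy, smul_zero] at this
    exact this.symm
  have g1 : A.unit ≤ |m| + |m'| + (c + c' + 1) • x := by
    refine h.trans (add_le_add ((le_abs_self m).trans ?_) ?_)
    · exact le_add_of_nonneg_right (abs_nonneg m')
    · exact smul_le_smul_of_nonneg_right (by linarith) hx0
  have g2 : A.unit ≤ |m| + |m'| + (c + c' + 1) • y := by
    refine h'.trans (add_le_add ((le_abs_self m').trans ?_) ?_)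
    · exact le_add_of_nonneg_left (abs_nonneg m)
    · exact smul_le_smul_of_nonneg_right (by linarith) hy0
  have g := le_inf g1 g2
  rw [← add_inf, e, add_zero] at g
  exact M.not_smul_unit_le one_pos (M.ideal.add_mem (M.abs_mem hm) (M.abs_mem hm'))
    (by rwa [one_smul])

theorem Yosida.exists_sub_smul_unit_mem (a : A) : ∃ r : ℝ, a - r • A.unit ∈ M.ideal := by
  obtain ⟨n, hn⟩ := A.exists_abs_le a
  rw [← Nat.cast_smul_eq_nsmul ℝ] at hn
  set S : Set ℝ := {r | (r • A.unit - a) ⊔ 0 ∈ M.ideal}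
  have hne : (-(n : ℝ)) ∈ S := by
    have : (-(n : ℝ)) • A.unit - a ≤ 0 := by
      rw [neg_smul, sub_nonpos]
      exact neg_le.1 ((neg_le_abs a).trans hn)
    change (-(n : ℝ) • A.unit - a) ⊔ 0 ∈ M.ideal
    rw [sup_eq_right.2 this]
    exact M.ideal.zero_mem
  have hbd : ∀ r ∈ S, r ≤ n := by
    intro r hr
    by_contra hlt
    rw [not_le] at hlt
    refine M.not_smul_unit_le (sub_pos.2 hlt) hr (le_trans ?_ le_sup_left)
    rw [sub_smul]
    exact sub_le_sub_left ((le_abs_self a).trans hn) _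
  have hdown : ∀ r ∈ S, ∀ s ≤ r, s ∈ S := fun r hr s hs =>
    M.of_le hr le_sup_right (sup_le_sup_right
      (sub_le_sub_right (smul_le_smul_of_nonneg_right hs A.unit_nonneg) a) 0)
  set r := sSup S with hr
  have low : ∀ ε : ℝ, 0 < ε → (r - ε) ∈ S := by
    intro ε hε
    obtain ⟨s, hs, hlt⟩ := exists_lt_of_lt_csSup ⟨_, hne⟩ (show r - ε < sSup S by linarith)
    exact hdown s hs _ hlt.le
  have high : ∀ ε : ℝ, 0 < ε → (a - (r + ε) • A.unit) ⊔ 0 ∈ M.ideal := by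
    intro ε hε
    have h1 : r + ε ∉ S := fun h => by
      have := le_csSup ⟨(n : ℝ), hbd⟩ h
      linarith
    have h2 := M.mem_or_mem_of_inf_eq_zero
      (posPart_inf_negPart_eq_zero ((r + ε) • A.unit - a))
    rw [posPart_def, negPart_def, neg_sub] at h2
    exact h2.resolve_left h1
  refine ⟨r, ?_⟩
  by_contra hd
  obtain ⟨m, hm, c, hc, h⟩ := M.exists_unit_le hd
  set ε : ℝ := 1 / (2 * (c + 1)) with hε
  have hεpos : 0 < ε := by positivity
  have hcε : c * ε ≤ 1 / 2 := by
    rw [hε, mul_one_div, div_le_div_iff₀ (by positivity) (by norm_num)]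
    linarith
  set p := (a - (r + ε) • A.unit) ⊔ 0 with hp
  set q := ((r - ε) • A.unit - a) ⊔ 0 with hq
  have hp0 : 0 ≤ p := le_sup_right
  have hq0 : 0 ≤ q := le_sup_right
  have hab : |a - r • A.unit| ≤ p + q + ε • A.unit := by
    refine abs_le'.2 ⟨?_, ?_⟩
    · have : a - r • A.unit = (a - (r + ε) • A.unit) + ε • A.unit := by rw [add_smul]; abel
      rw [this]
      exact add_le_add_left (le_sup_left.trans (le_add_of_nonneg_right hq0)) _
    · have : -(a - r • A.unit) = ((r - ε) • A.unit - a) + ε • A.unit := by rw [sub_smul]; abel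
      rw [this]
      exact add_le_add_left (le_sup_left.trans (le_add_of_nonneg_left hp0)) _
  have hmem : m + c • (p + q) ∈ M.ideal :=
    M.ideal.add_mem hm (M.ideal.smul_mem _ (M.ideal.add_mem (high ε hεpos) (low ε hεpos)))
  refine M.not_smul_unit_le (c := 1 - c * ε) (by linarith) hmem ?_
  rw [sub_smul, one_smul, sub_le_iff_le_add]
  refine (h.trans (add_le_add_right (smul_le_smul_of_nonneg_left hab hc) m)).trans ?_
  rw [smul_add c (p + q), smul_smul, add_assoc]

/-- The value `â(M)`: the real number `r` such that `a` and `r • u` agree modulo `M`. -/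
noncomputable def Yosida.value (a : A) : ℝ := (M.exists_sub_smul_unit_mem a).choose

theorem Yosida.value_spec (a : A) : a - M.value a • A.unit ∈ M.ideal :=
  (M.exists_sub_smul_unit_mem a).choose_spec

theorem Yosida.value_unique {a : A} {r : ℝ} (h : a - r • A.unit ∈ M.ideal) : M.value a = r := by
  by_contra hne
  have h1 := M.ideal.sub_mem h (M.value_spec a)
  rw [sub_sub_sub_cancel_left, ← sub_smul] at h1
  have h2 := M.ideal.smul_mem (M.value a - r)⁻¹ h1
  rw [smul_smul, inv_mul_cancel₀ (sub_ne_zero.2 hne), one_smul] at h2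
  exact M.unit_notMem h2

theorem Yosida.lt_value_iff (a : A) (r : ℝ) :
    r < M.value a ↔ (a - r • A.unit) ⊔ 0 ∉ M.ideal := by
  have hs := M.value_spec a
  constructor
  · intro hlt hmem
    refine M.not_smul_unit_le (sub_pos.2 hlt) (M.ideal.add_mem hmem (M.abs_mem hs)) ?_
    have : (M.value a - r) • A.unit = (a - r • A.unit) + -(a - M.value a • A.unit) := by
      rw [sub_smul]; abel
    rw [this]
    exact add_le_add le_sup_left (neg_le_abs _)
  · intro h
    by_contra hle
    rw [not_lt] at hle
    refine h (M.of_le (M.sup_zero_mem hs) le_sup_right (sup_le_sup_right ?_ 0))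
    exact sub_le_sub_left (smul_le_smul_of_nonneg_right hle A.unit_nonneg) a

theorem Yosida.value_neg (a : A) : M.value (-a) = -M.value a := by
  refine M.value_unique ?_
  have := M.ideal.neg_mem (M.value_spec a)
  rwa [neg_sub, sub_eq_neg_add, ← sub_neg_eq_add, ← neg_smul] at this

theorem Yosida.continuous_value (a : A) : Continuous fun M : Yosida A => M.value a := by
  have key : ∀ (b : A) (r : ℝ), IsOpen {M : Yosida A | r < M.value b} := by
    intro b r
    refine TopologicalSpace.isOpen_generateFrom_of_mem ⟨(b - r • A.unit) ⊔ 0, ?_⟩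
    ext M
    exact (M.lt_value_iff b r).symm
  refine continuous_generateFrom_iff.2 ?_ |> fun h => (OrderTopology.topology_eq_generate_intervals
    (α := ℝ)).symm ▸ h
  rintro s ⟨r, rfl | rfl⟩
  · exact key a r
  · have := key (-a) (-r)
    simp only [Yosida.value_neg, neg_lt_neg_iff] at this
    exact this

end PointEvaluation

/-- The Yosida embedding `ν_A : A → C(YA)`. -/
noncomputable def yosidaEmbedding (A : WStar.{u}) (a : A) : C(Yosida A, ℝ) :=
  ⟨fun M => M.value a, Yosida.continuous_value a⟩

end WStar

open WStar

/-- The elements of `{A ∈ W* : YA = K}`: an object `A` of `W*` with an identification of its Yosida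
space with `K`. -/
structure Over (K : Type u) [TopologicalSpace K] where
  /-- the object of `W*` -/
  obj : WStar.{u}
  /-- the identification `K = YA` -/
  homeo : K ≃ₜ Yosida obj

variable {K : Type u} [TopologicalSpace K]

/-- The Yosida embedding of `A`, read in `C(K)` through the identification `K = YA`. -/
noncomputable def Over.nu (A : Over K) (a : A.obj) : C(K, ℝ) :=
  (yosidaEmbedding A.obj a).comp ⟨A.homeo, A.homeo.continuous⟩

/-- `A ≤ B` if there is an essential embedding `f : A → B` with `ν_A = ν_B ∘ f`. -/
instance : Preorder (Over K) where
  le A B := ∃ f : Hom A.obj B.obj, IsEssentialEmbedding f ∧ ∀ a, A.nu a = B.nu (f a)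
  le_refl A := ⟨Hom.id A.obj, ⟨fun _ _ h => h, fun _ _ h => h⟩, fun _ => rfl⟩
  le_trans A B C := by
    rintro ⟨f, hf, hfν⟩ ⟨g, hg, hgν⟩
    exact ⟨g.comp f, ⟨hg.1.comp hf.1, fun D k hk => hg.2 D k (hf.2 D (k.comp g) hk)⟩,
      fun a => (hfν a).trans (hgν (f a))⟩

/-- The poset `{A ∈ W* : YA = K}`: `A` and `B` are identified if `A ≤ B` and `B ≤ A`. -/
abbrev YosidaPoset (K : Type u) [TopologicalSpace K] : Type (u + 1) :=
  Antisymmetrization (Over K) (· ≤ ·)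

/-- A space is zero-dimensional if its clopen sets form a base. -/
def IsZeroDimensional (K : Type u) [TopologicalSpace K] : Prop :=
  TopologicalSpace.IsTopologicalBasis {U : Set K | IsClopen U}

/-- A vector sublattice of `C(K)` that contains the constant function `1`, as an object of `W*` with
unit `1`. -/
def WStar.ofSubmodule [CompactSpace K] (S : Submodule ℝ C(K, ℝ))
    (hsup : ∀ f ∈ S, ∀ g ∈ S, f ⊔ g ∈ S) (hinf : ∀ f ∈ S, ∀ g ∈ S, f ⊓ g ∈ S)
    (hone : (1 : C(K, ℝ)) ∈ S) : WStar.{u} :=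
  letI : Lattice S := Subtype.lattice (fun {f g} hf hg => hsup f hf g hg)
    (fun {f g} hf hg => hinf f hf g hg)
  { carrier := S
    isOrderedAddMonoid := { add_le_add_left := fun f g h k x => add_le_add_left (h x) (k.1 x) }
    isOrderedModule :=
      { smul_le_smul_of_nonneg_left := fun c hc f g h x => mul_le_mul_of_nonneg_left (h x) hc
        smul_le_smul_of_nonneg_right := fun f hf c d h x => mul_le_mul_of_nonneg_right h (hf x) }
    archimedean := fun f g h x => by
      by_contra hx
      rw [not_le] at hx
      obtain ⟨n, hn⟩ := exists_nat_gt (g.1 x / f.1 x)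
      have h1 : n • f.1 x ≤ g.1 x := h n x
      rw [nsmul_eq_mul] at h1
      exact absurd ((div_lt_iff₀ hx).1 hn) (not_lt.2 h1)
    unit := ⟨1, hone⟩
    unit_nonneg := fun _ => zero_le_one
    exists_abs_le := fun f => by
      obtain ⟨n, hn⟩ := exists_nat_ge ‖f.1‖
      refine ⟨n, fun x => ?_⟩
      have h1 : |f.1 x| ≤ n := (f.1.norm_coe_le_norm x).trans hn
      change f.1 x ⊔ -f.1 x ≤ n • (1 : ℝ)
      rw [nsmul_eq_mul, mul_one]
      exact h1 }

/-- The continuous real-valued functions on `K` with finite range, as a subspace of `C(K)`. -/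
def finiteRange (K : Type u) [TopologicalSpace K] : Submodule ℝ C(K, ℝ) where
  carrier := {f | (Set.range f).Finite}
  zero_mem' := (Set.finite_singleton (0 : ℝ)).subset (by rintro _ ⟨x, rfl⟩; rfl)
  add_mem' {f g} hf hg := (hf.image2 (· + ·) hg).subset (by
    rintro _ ⟨x, rfl⟩; exact ⟨f x, ⟨x, rfl⟩, g x, ⟨x, rfl⟩, rfl⟩)
  smul_mem' c f hf := (hf.image (c * ·)).subset (by
    rintro _ ⟨x, rfl⟩; exact ⟨f x, ⟨x, rfl⟩, rfl⟩)

/-- `F(K)`, the vector lattice of the continuous real-valued functions on `K` with finite range,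
with unit `1`, as an object of `W*`. -/
def F (K : Type u) [TopologicalSpace K] [CompactSpace K] : WStar.{u} :=
  WStar.ofSubmodule (finiteRange K)
    (fun f hf g hg => (Set.Finite.image2 (· ⊔ ·) hf hg).subset (by
      rintro _ ⟨x, rfl⟩; exact ⟨f x, ⟨x, rfl⟩, g x, ⟨x, rfl⟩, rfl⟩))
    (fun f hf g hg => (Set.Finite.image2 (· ⊓ ·) hf hg).subset (by
      rintro _ ⟨x, rfl⟩; exact ⟨f x, ⟨x, rfl⟩, g x, ⟨x, rfl⟩, rfl⟩))
    ((Set.finite_singleton (1 : ℝ)).subset (by rintro _ ⟨x, rfl⟩; rfl))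

/-- An element of `F(K)`, viewed in `C(K)`. -/
def F.toC [CompactSpace K] (f : F K) : C(K, ℝ) := Subtype.val (p := (· ∈ finiteRange K)) f

end YosidaMin

namespace YosidaMin

open Filter Topology

namespace WStar

variable {A : WStar.{u}}

/-! The Yosida embedding makes each `A` over `K` a point-separating vector sublattice of `C(K)`
containing `1` (`Over.nu_injective`), hence uniformly dense by Stone–Weierstrass
(`Over.exists_abs_nu_sub_lt`). Density puts a nonzero positive element of `A` below every nonzero
positive function, so a mere inclusion of images is already an essential embedding
(`Over.le_of_forall_exists_nu_eq`). Conversely, every point-separating unital vector sublattice of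
`C(K)` has Yosida space `K` (`ofSubmodule.homeo`). The order is therefore inclusion of such
sublattices.

Truncating an approximation shows that each of them contains all indicators of clopen sets, hence
all continuous functions of finite range. If `K` is zero-dimensional, these functions separate
points, so `F(K)` is the minimum.

If a minimum exists, it lies, for every `p`, inside the sublattice of functions constant near `p`.
All its elements are then locally constant, and being dense they yield enough clopen sets for a
base. -/

/-! ### Point evaluations as lattice homomorphisms -/

theorem Yosida.value_add (M : Yosida A) (a b : A) : M.value (a + b) = M.value a + M.value b := by
  refine M.value_unique ?_
  have := M.ideal.add_mem (M.value_spec a) (M.value_spec b)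
  rwa [sub_add_sub_comm, ← add_smul] at this

theorem Yosida.value_smul (M : Yosida A) (c : ℝ) (a : A) : M.value (c • a) = c * M.value a := by
  refine M.value_unique ?_
  have := M.ideal.smul_mem c (M.value_spec a)
  rwa [smul_sub, smul_smul] at this

theorem Yosida.value_unit (M : Yosida A) : M.value A.unit = 1 :=
  M.value_unique (by rw [one_smul, sub_self]; exact M.ideal.zero_mem)

theorem Yosida.value_eq_zero_iff (M : Yosida A) (a : A) : M.value a = 0 ↔ a ∈ M.ideal := by
  constructor
  · intro h
    simpa [h] using M.value_spec a
  · intro h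
    exact M.value_unique (by simpa using h)

theorem Yosida.value_sup (M : Yosida A) (a b : A) :
    M.value (a ⊔ b) = M.value a ⊔ M.value b := by
  refine M.value_unique ?_
  have hsup : (M.value a ⊔ M.value b) • A.unit = M.value a • A.unit ⊔ M.value b • A.unit := by
    have hmono : Monotone fun r : ℝ => r • A.unit :=
      fun _ _ h => smul_le_smul_of_nonneg_right h A.unit_nonneg
    exact hmono.map_sup _ _
  have hmem := M.ideal.add_mem (M.abs_mem (M.value_spec a)) (M.abs_mem (M.value_spec b))
  refine M.solid hmem ?_
  -- Replace `a`, then `b`, by its scalar multiple of the unit: `⊔` is 1-Lipschitz in each variable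
  -- for the absolute value.
  rw [hsup, abs_of_nonneg (a := |_| + |_|) (add_nonneg (abs_nonneg _) (abs_nonneg _)),
    ← sub_add_sub_cancel (a ⊔ b) (M.value a • A.unit ⊔ b)]
  refine (abs_add_le _ _).trans (add_le_add (abs_sup_sub_sup_le_abs _ _ _) ?_)
  rw [sup_comm _ b, sup_comm _ (M.value b • A.unit)]
  exact abs_sup_sub_sup_le_abs _ _ _

theorem Yosida.value_inf (M : Yosida A) (a b : A) :
    M.value (a ⊓ b) = M.value a ⊓ M.value b := by
  have h := congrArg M.value (inf_add_sup a b)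
  rw [M.value_add, M.value_add, M.value_sup] at h
  linarith [inf_add_sup (M.value a) (M.value b)]

theorem Yosida.ext_value {M N : Yosida A} (h : ∀ a, M.value a = N.value a) : M = N := by
  refine Subtype.ext (SetLike.ext fun a => ?_)
  change a ∈ M.ideal ↔ a ∈ N.ideal
  rw [← M.value_eq_zero_iff, ← N.value_eq_zero_iff, h a]

instance : T2Space (Yosida A) := by
  refine T2Space.of_injective_continuous (f := fun (M : Yosida A) (a : A) => M.value a)
    (fun M N h => Yosida.ext_value (congrFun h)) (continuous_pi Yosida.continuous_value)

/-! ### Points separate elements of an Archimedean lattice -/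

/-- Every ideal that does not contain the unit is contained in a point of the Yosida space. -/
theorem exists_le_yosida {I : Submodule ℝ A} (hI : A.IsIdeal I) (hu : A.unit ∉ I) :
    ∃ M : Yosida A, I ≤ M.ideal := by
  obtain ⟨M, hIM, hM⟩ := zorn_le_nonempty₀ {I : Submodule ℝ A | A.IsIdeal I ∧ A.unit ∉ I}
    (fun c hc hchain J hJ => by
      have hmem : ∀ x, x ∈ sSup c ↔ ∃ s ∈ c, x ∈ s := fun x =>
        Submodule.mem_sSup_of_directed ⟨J, hJ⟩ hchain.directedOn
      refine ⟨sSup c, ⟨fun x hx y hy => ?_, fun hx => ?_⟩, fun s hs => le_sSup hs⟩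
      · obtain ⟨s, hs, hxs⟩ := (hmem x).1 hx
        exact (hmem y).2 ⟨s, hs, (hc hs).1 x hxs y hy⟩
      · obtain ⟨s, hs, hxs⟩ := (hmem _).1 hx
        exact (hc hs).2 hxs) I ⟨hI, hu⟩
  exact ⟨⟨M, hM⟩, hIM⟩

/-- The ideal of the elements bounded by a multiple of `c`. -/
def principalIdeal (A : WStar.{u}) (c : A) : Submodule ℝ A where
  carrier := {x | ∃ k : ℝ, 0 ≤ k ∧ |x| ≤ k • c}
  zero_mem' := ⟨0, le_rfl, by simp⟩
  add_mem' := by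
    rintro x y ⟨k, hk, h⟩ ⟨l, hl, h'⟩
    exact ⟨k + l, add_nonneg hk hl,
      (abs_add_le x y).trans ((add_le_add h h').trans (add_smul k l c).ge)⟩
  smul_mem' := by
    rintro d x ⟨k, hk, h⟩
    refine ⟨|d| * k, by positivity, (abs_smul_le d x).trans ?_⟩
    rw [mul_smul]
    exact smul_le_smul_of_nonneg_left h (abs_nonneg d)

theorem isIdeal_principalIdeal (c : A) : A.IsIdeal (A.principalIdeal c) := by
  rintro x ⟨k, hk, h⟩ y hy
  exact ⟨k, hk, hy.trans h⟩

/-- Disjointness survives scaling: with `d = |t| + 1`, the element `b` lies below both `d • b` and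
`d • c`, whose infimum is `0`. -/
theorem eq_zero_of_le_smul_of_inf_eq_zero {b c : A} (hbc : b ⊓ c = 0) {t : ℝ}
    (h : b ≤ t • c) : b = 0 := by
  have hb : 0 ≤ b := hbc ▸ inf_le_left
  have hc : 0 ≤ c := hbc ▸ inf_le_right
  have hd : 0 < |t| + 1 := by positivity
  have e := (OrderIso.smulRight (β := A) hd).map_inf b c
  simp only [OrderIso.smulRight_apply, hbc, smul_zero] at e
  refine le_antisymm (e ▸ le_inf ?_ (h.trans ?_)) hb
  · simpa using smul_le_smul_of_nonneg_right (show (1 : ℝ) ≤ |t| + 1 by simp) hb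
  · exact smul_le_smul_of_nonneg_right ((le_abs_self t).trans (by simp)) hc

/-- The Archimedean axiom reduces this to `n • a ≤ u` for all `n`. If this fails, `d = n • a - u`
has nonzero positive part, so some point `M` contains `d⁻`. Since `u ≤ n • a + d⁻` and `a ∈ M`, the
unit would lie in `M`. -/
theorem eq_zero_of_forall_mem {a : A} (ha : 0 ≤ a) (h : ∀ M : Yosida A, a ∈ M.ideal) :
    a = 0 := by
  refine le_antisymm (A.archimedean a A.unit fun n => ?_) ha
  by_contra hn
  set d := n • a - A.unit with hd
  have hpos : d⁺ ≠ 0 := fun h0 => hn (sub_nonpos.1 (posPart_eq_zero.1 h0))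
  -- Otherwise `d⁺`, bounded by a multiple of the unit, would be bounded by a multiple of the
  -- disjoint element `d⁻`, hence vanish.
  have hu : A.unit ∉ A.principalIdeal d⁻ := by
    rintro ⟨k, hk, hle⟩
    obtain ⟨m, hm⟩ := A.exists_abs_le d⁺
    rw [← Nat.cast_smul_eq_nsmul ℝ] at hm
    refine hpos (eq_zero_of_le_smul_of_inf_eq_zero (posPart_inf_negPart_eq_zero d)
      (t := (m : ℝ) * k) ((le_abs_self _).trans (hm.trans ?_)))
    rw [mul_smul]
    exact smul_le_smul_of_nonneg_left ((le_abs_self _).trans hle) (Nat.cast_nonneg m)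
  obtain ⟨M, hM⟩ := exists_le_yosida (isIdeal_principalIdeal _) hu
  have hneg : d⁻ ∈ M.ideal :=
    hM ⟨1, zero_le_one, by rw [one_smul, abs_of_nonneg (negPart_nonneg d)]⟩
  refine M.unit_notMem (M.of_le (M.ideal.add_mem (M.ideal.smul_mem (n : ℝ) (h M)) hneg)
    A.unit_nonneg ?_)
  have : -d ≤ d⁻ := neg_le_negPart d
  rw [Nat.cast_smul_eq_nsmul]
  calc A.unit = n • a + -d := by rw [hd]; abel
    _ ≤ _ := add_le_add_right this _

theorem Hom.map_abs {A B : WStar.{u}} (g : Hom A B) (a : A) : g |a| = |g a| := by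
  have h := g.map_sup a (-a)
  rwa [show g.toFun (-a) = -g.toFun a from g.toLinearMap.map_neg a] at h

theorem Hom.mono {A B : WStar.{u}} (g : Hom A B) {a b : A} (h : a ≤ b) : g a ≤ g b := by
  have := g.map_sup a b
  rw [sup_eq_right.2 h] at this
  exact sup_eq_right.1 this.symm

/-! ### The Yosida space of a vector sublattice of `C(K)` -/

section OfSubmodule

variable {K : Type u} [TopologicalSpace K] [CompactSpace K] {S : Submodule ℝ C(K, ℝ)}
  (hsup : ∀ f ∈ S, ∀ g ∈ S, f ⊔ g ∈ S) (hinf : ∀ f ∈ S, ∀ g ∈ S, f ⊓ g ∈ S)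
  (hone : (1 : C(K, ℝ)) ∈ S)

/-- An element of a vector sublattice of `C(K)`, viewed in `C(K)`. -/
def ofSubmodule.toC (f : ofSubmodule S hsup hinf hone) : C(K, ℝ) := Subtype.val (p := (· ∈ S)) f

/-- The point of the Yosida space given by evaluation at a point of `K`. -/
def ofSubmodule.point (x : K) : Yosida (ofSubmodule S hsup hinf hone) :=
  let P : Submodule ℝ (ofSubmodule S hsup hinf hone) :=
    { carrier := {f | toC hsup hinf hone f x = 0}
      zero_mem' := rfl
      add_mem' := fun {f g} (hf : _ = _) (hg : _ = _) => by
        change toC hsup hinf hone f x + toC hsup hinf hone g x = 0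
        rw [hf, hg, add_zero]
      smul_mem' := fun c f (hf : _ = _) => by
        change c * toC hsup hinf hone f x = 0
        rw [hf, mul_zero] }
  ⟨P, ⟨fun f (hf : _ = _) g hg => by
      have h : |toC hsup hinf hone g x| ≤ |toC hsup hinf hone f x| := hg x
      rw [hf, abs_zero] at h
      exact abs_nonpos_iff.1 h, fun h => one_ne_zero (α := ℝ) h⟩,
    fun J hJ hPJ f hf => by
      by_contra hx
      have hx : toC hsup hinf hone f x ≠ 0 := hx
      -- The evaluation kernel has codimension one, so adjoining any `f` with `f x ≠ 0` forces the
      -- unit in.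
      have h1 : f - toC hsup hinf hone f x • (ofSubmodule S hsup hinf hone).unit ∈ P := by
        change toC hsup hinf hone f x - toC hsup hinf hone f x * 1 = 0
        ring
      have h2 := J.smul_mem (toC hsup hinf hone f x)⁻¹ (J.sub_mem hf (hPJ h1))
      rw [sub_sub_cancel, smul_smul, inv_mul_cancel₀ hx, one_smul] at h2
      exact hJ.2 h2⟩

theorem ofSubmodule.value_point (x : K) (f : ofSubmodule S hsup hinf hone) :
    (point hsup hinf hone x).value f = toC hsup hinf hone f x := by
  refine Yosida.value_unique _ ?_
  change toC hsup hinf hone f x - toC hsup hinf hone f x * 1 = 0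
  ring

theorem ofSubmodule.continuous_point : Continuous (point hsup hinf hone) := by
  refine continuous_generateFrom_iff.2 ?_
  rintro _ ⟨f, rfl⟩
  exact isOpen_ne_fun (toC hsup hinf hone f).continuous continuous_const

/-- If `M` lay in no evaluation ideal, compactness would give a finite sum of `|f x|` in `M` that is
positive everywhere. It is then bounded below by some `ε > 0`, which puts the unit in `M`. Once `M`
lies in an evaluation ideal, maximality gives equality. -/
theorem ofSubmodule.surjective_point : Function.Surjective (point hsup hinf hone) := by
  intro M
  suffices h : ∃ x, M.ideal ≤ (point hsup hinf hone x).ideal by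
    obtain ⟨x, hx⟩ := h
    exact ⟨x, Subtype.ext ((M.2.le_of_ge (point hsup hinf hone x).2.prop hx).antisymm hx)⟩
  by_contra hcon
  push Not at hcon
  have hf : ∀ x, ∃ f ∈ M.ideal, toC hsup hinf hone f x ≠ 0 := fun x =>
    SetLike.not_le_iff_exists.1 (hcon x)
  choose f hfM hfx using hf
  obtain ⟨t, ht⟩ := isCompact_univ.elim_finite_subcover
    (fun x => {y | toC hsup hinf hone (f x) y ≠ 0})
    (fun x => isOpen_ne_fun (toC hsup hinf hone (f x)).continuous continuous_const)
    (fun x _ => Set.mem_iUnion.2 ⟨x, hfx x⟩)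
  set g : ofSubmodule S hsup hinf hone := ∑ x ∈ t, |f x| with hg
  have hgM : g ∈ M.ideal := M.ideal.sum_mem fun x _ => M.abs_mem (hfM x)
  have hgy : ∀ y, toC hsup hinf hone g y = ∑ x ∈ t, |toC hsup hinf hone (f x) y| := by
    intro y
    let φ : (ofSubmodule S hsup hinf hone) →+ ℝ :=
      { toFun := fun h => toC hsup hinf hone h y, map_zero' := rfl, map_add' := fun _ _ => rfl }
    exact map_sum φ _ _
  have hpos : ∀ y, 0 < toC hsup hinf hone g y := by
    intro y
    obtain ⟨x, hx, hxy⟩ := Set.mem_iUnion₂.1 (ht (Set.mem_univ y))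
    rw [hgy]
    exact Finset.sum_pos' (fun _ _ => abs_nonneg _) ⟨x, hx, abs_pos.2 hxy⟩
  obtain ⟨ε, hε, hle⟩ : ∃ ε : ℝ, 0 < ε ∧ ∀ y, ε ≤ toC hsup hinf hone g y := by
    rcases isEmpty_or_nonempty K with hK | hK
    · exact ⟨1, one_pos, fun y => hK.elim y⟩
    · obtain ⟨y, -, hy⟩ := isCompact_univ.exists_isMinOn Set.univ_nonempty
        (toC hsup hinf hone g).continuous.continuousOn
      exact ⟨_, hpos y, fun z => hy (Set.mem_univ z)⟩
  refine M.not_smul_unit_le hε hgM fun y => ?_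
  change ε * 1 ≤ toC hsup hinf hone g y
  rw [mul_one]
  exact hle y

/-- A point-separating unital vector sublattice of `C(K)` has Yosida space `K`. -/
noncomputable def ofSubmodule.homeo (hsep : ∀ x y : K, x ≠ y → ∃ f ∈ S, f x ≠ f y) :
    K ≃ₜ Yosida (ofSubmodule S hsup hinf hone) :=
  (continuous_point hsup hinf hone).homeoOfEquivCompactToT2
    (f := Equiv.ofBijective (point hsup hinf hone) ⟨fun x y hxy => by
      by_contra hne
      obtain ⟨f, hf, hfxy⟩ := hsep x y hne
      refine hfxy ?_
      have h := congrArg (fun M : Yosida (ofSubmodule S hsup hinf hone) => M.value ⟨f, hf⟩) hxy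
      exact (value_point hsup hinf hone x ⟨f, hf⟩).symm.trans
        (h.trans (value_point hsup hinf hone y ⟨f, hf⟩)), surjective_point hsup hinf hone⟩)

theorem ofSubmodule.nu_homeo (hsep : ∀ x y : K, x ≠ y → ∃ f ∈ S, f x ≠ f y)
    (f : ofSubmodule S hsup hinf hone) :
    Over.nu ⟨ofSubmodule S hsup hinf hone, homeo hsup hinf hone hsep⟩ f =
      toC hsup hinf hone f :=
  ContinuousMap.ext fun x => value_point hsup hinf hone x f

end OfSubmodule

end WStar

open WStar

/-! ### Density of the Yosida image, and the order as inclusion -/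

namespace Over

variable {K : Type u} [TopologicalSpace K] (A : Over K)

theorem nu_add (a b : A.obj) : A.nu (a + b) = A.nu a + A.nu b :=
  ContinuousMap.ext fun _ => Yosida.value_add _ a b

theorem nu_smul (c : ℝ) (a : A.obj) : A.nu (c • a) = c • A.nu a :=
  ContinuousMap.ext fun _ => Yosida.value_smul _ c a

theorem nu_sup (a b : A.obj) : A.nu (a ⊔ b) = A.nu a ⊔ A.nu b :=
  ContinuousMap.ext fun _ => Yosida.value_sup _ a b

theorem nu_inf (a b : A.obj) : A.nu (a ⊓ b) = A.nu a ⊓ A.nu b :=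
  ContinuousMap.ext fun _ => Yosida.value_inf _ a b

theorem nu_unit : A.nu A.obj.unit = 1 :=
  ContinuousMap.ext fun _ => Yosida.value_unit _

/-- The Yosida embedding as a linear map. -/
noncomputable def nuLinear : A.obj →ₗ[ℝ] C(K, ℝ) where
  toFun := A.nu
  map_add' := A.nu_add
  map_smul' := A.nu_smul

theorem nu_injective : Function.Injective A.nu := by
  change Function.Injective A.nuLinear
  refine (injective_iff_map_eq_zero _).2 fun a ha => ?_
  have h : |a| = 0 := eq_zero_of_forall_mem (abs_nonneg a) fun M => by
    refine M.abs_mem ((M.value_eq_zero_iff a).1 ?_)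
    have := DFunLike.congr_fun ha (A.homeo.symm M)
    change (A.homeo (A.homeo.symm M)).value a = 0 at this
    rwa [A.homeo.apply_symm_apply] at this
  exact le_antisymm (h ▸ le_abs_self a) (neg_nonpos.1 (h ▸ neg_le_abs a))

theorem nu_le_iff {a b : A.obj} : A.nu a ≤ A.nu b ↔ a ≤ b := by
  rw [← sup_eq_right, ← nu_sup, A.nu_injective.eq_iff, sup_eq_right]

theorem exists_nu_ne {x y : K} (hxy : x ≠ y) : ∃ a, A.nu a x ≠ A.nu a y := by
  by_contra! h
  exact hxy (A.homeo.injective (Yosida.ext_value h))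

theorem separatesPointsStrongly_range_nu :
    (Set.range A.nu).SeparatesPointsStrongly := by
  intro v x y
  by_cases hxy : x = y
  · subst hxy
    refine ⟨A.nu (v x • A.obj.unit), ⟨_, rfl⟩, ?_⟩
    simp [nu_smul, nu_unit]
  · obtain ⟨a, ha⟩ := A.exists_nu_ne hxy
    have hd : A.nu a x - A.nu a y ≠ 0 := sub_ne_zero.2 ha
    set t := (v x - v y) / (A.nu a x - A.nu a y) with ht
    have htd : t * (A.nu a x - A.nu a y) = v x - v y := div_mul_cancel₀ _ hd
    refine ⟨A.nu (t • a + (v x - t * A.nu a x) • A.obj.unit), ⟨_, rfl⟩, ?_, ?_⟩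
    · simp [nu_add, nu_smul, nu_unit]
    · simp only [nu_add, nu_smul, nu_unit, ContinuousMap.add_apply, ContinuousMap.smul_apply,
        ContinuousMap.one_apply, smul_eq_mul]
      linarith

variable [CompactSpace K]

/-- The image of the Yosida embedding is uniformly dense. -/
theorem exists_abs_nu_sub_lt (h : C(K, ℝ)) {ε : ℝ} (hε : 0 < ε) :
    ∃ a, ∀ x, |A.nu a x - h x| < ε := by
  have hd : closure (Set.range A.nu) = ⊤ := ContinuousMap.sublattice_closure_eq_top _
    ⟨_, A.obj.unit, rfl⟩
    (by rintro _ ⟨a, rfl⟩ _ ⟨b, rfl⟩; exact ⟨a ⊓ b, A.nu_inf a b⟩)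
    (by rintro _ ⟨a, rfl⟩ _ ⟨b, rfl⟩; exact ⟨a ⊔ b, A.nu_sup a b⟩)
    A.separatesPointsStrongly_range_nu
  have hh : h ∈ closure (Set.range A.nu) := by rw [hd]; trivial
  obtain ⟨_, ⟨a, rfl⟩, ha⟩ := Metric.mem_closure_iff.1 hh ε hε
  refine ⟨a, fun x => ?_⟩
  have := ((ContinuousMap.dist_apply_le_dist x).trans_lt ha)
  rwa [dist_comm, Real.dist_eq] at this

/-- Below every positive continuous function there is a positive element of the image of the Yosida
embedding. -/
theorem exists_nu_le {h : C(K, ℝ)} (h0 : 0 ≤ h) (hne : h ≠ 0) :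
    ∃ a, 0 ≤ a ∧ a ≠ 0 ∧ A.nu a ≤ h := by
  obtain ⟨x, hx⟩ := DFunLike.ne_iff.1 hne
  have hx0 : 0 < h x := lt_of_le_of_ne (h0 x) (Ne.symm hx)
  -- With error below `h x / 3`, lowering `a` by `h x / 3` puts it under `h`, while its value at `x`
  -- stays above `h x / 3`.
  obtain ⟨a, ha⟩ := A.exists_abs_nu_sub_lt h (ε := h x / 3) (by linarith)
  have key : ∀ y, A.nu ((a - (h x / 3) • A.obj.unit) ⊔ 0) y = (A.nu a y - h x / 3) ⊔ 0 := by
    intro y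
    have h1 : A.nu (a - (h x / 3) • A.obj.unit) = A.nu a - (h x / 3) • 1 := by
      rw [sub_eq_add_neg, ← neg_smul, nu_add, nu_smul, nu_unit, neg_smul, ← sub_eq_add_neg]
    have h2 : A.nu 0 = 0 := A.nuLinear.map_zero
    simp [nu_sup, h1, h2]
  refine ⟨(a - (h x / 3) • A.obj.unit) ⊔ 0, le_sup_right, fun hz => ?_, fun y => ?_⟩
  · have h2 : A.nu 0 = 0 := A.nuLinear.map_zero
    have h3 := key x
    rw [hz, h2] at h3
    have h4 : A.nu a x - h x / 3 ≤ 0 := le_sup_left.trans h3.ge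
    linarith [(abs_lt.1 (ha x)).1]
  · refine (key y).trans_le ?_
    exact sup_le (show A.nu a y - h x / 3 ≤ h y by linarith [(abs_lt.1 (ha y)).2]) (h0 y)

/-- Injectivity of the Yosida embedding of `B` makes the lift a morphism. It is essential by order
density: if `g b = 0` with `b ≠ 0`, some nonzero `a ≥ 0` has image below `|b|`, so `g` kills that
image and `g ∘ φ` is not injective. -/
theorem le_of_forall_exists_nu_eq {A B : Over K} (hAB : ∀ a, ∃ b, B.nu b = A.nu a) : A ≤ B := by
  choose f hf using hAB
  let φ : Hom A.obj B.obj :=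
    { toFun := f
      map_add' := fun a b => B.nu_injective (by simp only [nu_add, hf])
      map_smul' := fun c a => B.nu_injective (by simp only [nu_smul, hf, RingHom.id_apply])
      map_sup := fun a b => B.nu_injective (by simp only [nu_sup, hf])
      map_inf := fun a b => B.nu_injective (by simp only [nu_inf, hf])
      map_unit := B.nu_injective (by simp only [nu_unit, hf]) }
  refine ⟨φ, ⟨fun a b hab => A.nu_injective ?_, fun C g hg => ?_⟩, fun a => (hf a).symm⟩
  · rw [← hf a, ← hf b]
    exact congrArg B.nu hab
  · refine (injective_iff_map_eq_zero g.toLinearMap).2 fun b hb => ?_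
    by_contra hne
    have hn0 : B.nu 0 = 0 := B.nuLinear.map_zero
    have habs : |b| ≠ 0 := fun h =>
      hne (le_antisymm (h ▸ le_abs_self b) (neg_nonpos.1 (h ▸ neg_le_abs b)))
    obtain ⟨a, ha0, hane, hle⟩ := A.exists_nu_le (h := B.nu |b|)
      (hn0 ▸ B.nu_le_iff.2 (abs_nonneg b)) (fun h => habs (B.nu_injective (h.trans hn0.symm)))
    have hfa : φ a ≤ |b| := B.nu_le_iff.1 ((hf a).trans_le hle)
    have h1 : g (φ a) ≤ 0 := by
      have := g.mono hfa
      rw [g.map_abs, show g.toFun b = 0 from hb, abs_zero] at this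
      exact this
    have hz : g (φ 0) = 0 := by
      rw [show φ.toFun 0 = 0 from φ.toLinearMap.map_zero]
      exact g.toLinearMap.map_zero
    have h2 : 0 ≤ g (φ a) := hz ▸ g.mono (φ.mono ha0)
    exact hane (hg ((le_antisymm h1 h2).trans hz.symm))

end Over

/-! ### Functions of finite range lie in every object over `K` -/

section ZeroDimensional

variable {K : Type u} [TopologicalSpace K]

/-- The characteristic function of a clopen set. -/
noncomputable def clopenIndicator (U : Set K) (hU : IsClopen U) : C(K, ℝ) :=
  ⟨U.indicator 1, continuous_one.indicator (by simp [hU.frontier_eq])⟩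

theorem Over.exists_nu_eq_clopenIndicator [CompactSpace K] (A : Over K) {U : Set K}
    (hU : IsClopen U) : ∃ a, A.nu a = clopenIndicator U hU := by
  -- The target is `2` on `U` and `-1` off `U`. An approximation within `1` exceeds `1` on `U` and
  -- is negative off `U`, so clipping to `[0, 1]` gives the indicator exactly.
  obtain ⟨a, ha⟩ := A.exists_abs_nu_sub_lt
    ((3 : ℝ) • clopenIndicator U hU - (1 : ℝ) • 1) one_pos
  refine ⟨(a ⊔ (0 : ℝ) • A.obj.unit) ⊓ A.obj.unit, ContinuousMap.ext fun x => ?_⟩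
  have h := abs_lt.1 (ha x)
  simp only [Over.nu_inf, Over.nu_sup, Over.nu_unit, Over.nu_smul, ContinuousMap.inf_apply,
    ContinuousMap.sup_apply, ContinuousMap.smul_apply, ContinuousMap.one_apply,
    ContinuousMap.sub_apply, smul_eq_mul, mul_one] at h ⊢
  by_cases hx : x ∈ U
  · have e : clopenIndicator U hU x = 1 := Set.indicator_of_mem hx _
    rw [e] at h ⊢
    exact inf_eq_right.2 (le_sup_of_le_left (by linarith [h.1]))
  · have e : clopenIndicator U hU x = 0 := Set.indicator_of_notMem hx _
    rw [e] at h ⊢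
    rw [sup_eq_right.2 (by linarith [h.2])]
    exact inf_eq_left.2 zero_le_one

theorem isClopen_fiber_of_finite_range {f : C(K, ℝ)} (hf : (Set.range f).Finite) (r : ℝ) :
    IsClopen (f ⁻¹' {r}) := by
  refine ⟨isClosed_singleton.preimage f.continuous, ?_⟩
  rw [← isClosed_compl_iff]
  have : (f ⁻¹' {r})ᶜ = f ⁻¹' (Set.range f \ {r}) := by ext x; simp
  rw [this]
  exact (hf.subset Set.sdiff_subset).isClosed.preimage f.continuous

theorem Over.exists_nu_eq_of_finite_range [CompactSpace K] (A : Over K) {f : C(K, ℝ)}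
    (hf : (Set.range f).Finite) : ∃ a, A.nu a = f := by
  have e : f = ∑ r ∈ hf.toFinset, r • clopenIndicator _ (isClopen_fiber_of_finite_range hf r) := by
    ext x
    rw [ContinuousMap.sum_apply, Finset.sum_eq_single (f x)]
    · have : clopenIndicator _ (isClopen_fiber_of_finite_range hf (f x)) x = 1 :=
        Set.indicator_of_mem (by simp) _
      simp [this]
    · intro r _ hr
      have : clopenIndicator _ (isClopen_fiber_of_finite_range hf r) x = 0 :=
        Set.indicator_of_notMem (by simpa using hr.symm) _
      simp [this]
    · simp
  have hmem : f ∈ LinearMap.range A.nuLinear := by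
    rw [e]
    exact Submodule.sum_mem _ fun r _ => Submodule.smul_mem _ _
      (A.exists_nu_eq_clopenIndicator (isClopen_fiber_of_finite_range hf r))
  exact hmem

theorem sup_mem_finiteRange :
    ∀ f ∈ finiteRange K, ∀ g ∈ finiteRange K, f ⊔ g ∈ finiteRange K := fun f hf g hg =>
  (Set.Finite.image2 (· ⊔ ·) hf hg).subset
    (by rintro _ ⟨x, rfl⟩; exact ⟨f x, ⟨x, rfl⟩, g x, ⟨x, rfl⟩, rfl⟩)

theorem inf_mem_finiteRange :
    ∀ f ∈ finiteRange K, ∀ g ∈ finiteRange K, f ⊓ g ∈ finiteRange K := fun f hf g hg =>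
  (Set.Finite.image2 (· ⊓ ·) hf hg).subset
    (by rintro _ ⟨x, rfl⟩; exact ⟨f x, ⟨x, rfl⟩, g x, ⟨x, rfl⟩, rfl⟩)

theorem one_mem_finiteRange : (1 : C(K, ℝ)) ∈ finiteRange K :=
  (Set.finite_singleton (1 : ℝ)).subset (by rintro _ ⟨x, rfl⟩; rfl)

theorem finiteRange_separates [T1Space K] (hK : IsZeroDimensional K) (x y : K) (hxy : x ≠ y) :
    ∃ f ∈ finiteRange K, f x ≠ f y := by
  obtain ⟨U, hU, hxU, hyU⟩ := hK.exists_subset_of_mem_open (Set.mem_compl_singleton_iff.2 hxy)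
    isOpen_compl_singleton
  refine ⟨clopenIndicator U hU, (Set.toFinite {0, 1}).subset ?_, ?_⟩
  · rintro _ ⟨z, rfl⟩
    rcases Set.indicator_eq_zero_or_self U (1 : K → ℝ) z with h | h
    · exact Or.inl h
    · exact Or.inr h
  · have h1 : clopenIndicator U hU x = 1 := Set.indicator_of_mem hxU _
    have h2 : clopenIndicator U hU y = 0 := Set.indicator_of_notMem (fun h => hyU h rfl) _
    rw [h1, h2]
    exact one_ne_zero

/-! ### Functions constant near a point, and the converse -/

/-- The continuous functions that are constant on a neighbourhood of `p`. -/
def constantNear (p : K) : Submodule ℝ C(K, ℝ) where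
  carrier := {f | ∀ᶠ x in 𝓝 p, f x = f p}
  zero_mem' := Eventually.of_forall fun _ => rfl
  add_mem' {f g} hf hg := by
    filter_upwards [hf, hg] with x hx hy
    simp [hx, hy]
  smul_mem' c f hf := by
    filter_upwards [hf] with x hx
    simp [hx]

theorem sup_mem_constantNear (p : K) :
    ∀ f ∈ constantNear p, ∀ g ∈ constantNear p, f ⊔ g ∈ constantNear p := fun f hf g hg => by
  filter_upwards [hf, hg] with x hx hy
  simp [hx, hy]

theorem inf_mem_constantNear (p : K) :
    ∀ f ∈ constantNear p, ∀ g ∈ constantNear p, f ⊓ g ∈ constantNear p := fun f hf g hg => by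
  filter_upwards [hf, hg] with x hx hy
  simp [hx, hy]

theorem one_mem_constantNear (p : K) : 1 ∈ constantNear p := Eventually.of_forall fun _ => rfl

variable [CompactSpace K] [T2Space K]

/-- At least one of the two points differs from `p`; call it `x`. A Urysohn function that is `1` at
`x` and `0` both at `y` and on a closed neighbourhood of `p` avoiding `x` is constant near `p`. -/
theorem constantNear_separates (p x y : K) (hxy : x ≠ y) :
    ∃ f ∈ constantNear p, f x ≠ f y := by
  wlog hxp : x ≠ p generalizing x y
  · obtain ⟨f, hf, hne⟩ := this y x hxy.symm fun h => hxy ((not_not.1 hxp).trans h.symm)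
    exact ⟨f, hf, hne.symm⟩
  obtain ⟨C, hC, hCcl, hCsub⟩ := exists_mem_nhds_isClosed_subset
    (isOpen_compl_singleton.mem_nhds (Set.mem_compl_singleton_iff.2 hxp.symm))
  obtain ⟨f, hf0, hf1, -⟩ := exists_continuous_zero_one_of_isClosed
    (hCcl.union (isClosed_singleton (x := y))) (isClosed_singleton (x := x))
    (Set.disjoint_singleton_right.2 (by
      rintro (h | h)
      · exact hCsub h rfl
      · exact hxy h))
  refine ⟨f, ?_, ?_⟩
  · filter_upwards [hC] with z hz
    rw [hf0 (Or.inl hz), hf0 (Or.inl (mem_of_mem_nhds hC))]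
    rfl
  · rw [hf1 rfl, hf0 (Or.inr rfl)]
    exact one_ne_zero

theorem isZeroDimensional_of_forall_le (A : Over K) (hA : ∀ B : Over K, A ≤ B) :
    IsZeroDimensional K := by
  have hloc : ∀ a, IsLocallyConstant (A.nu a) := by
    refine fun a => (IsLocallyConstant.iff_eventually_eq _).2 fun p => ?_
    -- Each `p` gives its own competitor; lying below it forces every element of `A` to be constant
    -- near `p`.
    obtain ⟨f, -, hf⟩ := hA ⟨_, ofSubmodule.homeo (sup_mem_constantNear p)
      (inf_mem_constantNear p) (one_mem_constantNear p) (constantNear_separates p)⟩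
    rw [hf a, ofSubmodule.nu_homeo]
    exact (f a).2
  refine TopologicalSpace.isTopologicalBasis_of_isOpen_of_nhds (fun U hU => hU.isOpen) ?_
  intro x U hxU hU
  obtain ⟨h, h0, h1, -⟩ := exists_continuous_zero_one_of_isClosed hU.isClosed_compl
    (isClosed_singleton (x := x)) (Set.disjoint_singleton_right.2 fun hx => hx hxU)
  -- Since `h` is `1` at `x` and `0` off `U`, the superlevel set of the approximation at `1 / 2`
  -- contains `x` and stays inside `U`. It is clopen by local constancy.
  obtain ⟨a, ha⟩ := A.exists_abs_nu_sub_lt h (ε := 1 / 2) (by norm_num)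
  refine ⟨A.nu a ⁻¹' Set.Ioi ((1 : ℝ) / 2), ⟨?_, hloc a _⟩, ?_, fun y hy => ?_⟩
  · exact isOpen_compl_iff.1 (hloc a (Set.Ioi ((1 : ℝ) / 2))ᶜ)
  · have h2 := (abs_lt.1 (ha x)).1
    rw [h1 rfl, Pi.one_apply] at h2
    have h3 : 1 / 2 < A.nu a x := by linarith
    exact h3
  · by_contra hyU
    have h2 := (abs_lt.1 (ha y)).2
    rw [h0 hyU, Pi.zero_apply] at h2
    have h3 : 1 / 2 < A.nu a y := hy
    linarith

theorem exists_homeo_yosida_F (hK : IsZeroDimensional K) :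
    ∃ η : K ≃ₜ Yosida (F K), (∀ f : F K, Over.nu ⟨F K, η⟩ f = F.toC f) ∧
      IsLeast (Set.univ : Set (YosidaPoset K))
        (toAntisymmetrization (· ≤ ·) (⟨F K, η⟩ : Over K)) := by
  let η : K ≃ₜ Yosida (F K) := ofSubmodule.homeo sup_mem_finiteRange inf_mem_finiteRange
    one_mem_finiteRange (finiteRange_separates hK)
  have hν : ∀ f : F K, Over.nu ⟨F K, η⟩ f = F.toC f :=
    ofSubmodule.nu_homeo sup_mem_finiteRange inf_mem_finiteRange
      one_mem_finiteRange (finiteRange_separates hK)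
  refine ⟨η, hν, Set.mem_univ _, fun m _ => ?_⟩
  induction m using Antisymmetrization.ind with
  | _ B =>
    refine toAntisymmetrization_le_toAntisymmetrization_iff.2
      (Over.le_of_forall_exists_nu_eq fun a => ?_)
    obtain ⟨b, hb⟩ := B.exists_nu_eq_of_finite_range (f := F.toC a) a.2
    exact ⟨b, hb.trans (hν a).symm⟩

end ZeroDimensional

end YosidaMin

theorem mainTheorem4 (K : Type u) [TopologicalSpace K] [CompactSpace K] [T2Space K] :
    ((∃ m : YosidaMin.YosidaPoset K, IsLeast Set.univ m) ↔ YosidaMin.IsZeroDimensional K) ∧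
    (YosidaMin.IsZeroDimensional K →
      ∃ η : K ≃ₜ YosidaMin.WStar.Yosida (YosidaMin.F K),
        (∀ f : YosidaMin.F K,
          YosidaMin.Over.nu ⟨YosidaMin.F K, η⟩ f = YosidaMin.F.toC f) ∧
        IsLeast (Set.univ : Set (YosidaMin.YosidaPoset K))
          (toAntisymmetrization (· ≤ ·) (⟨YosidaMin.F K, η⟩ : YosidaMin.Over K))) := by
  refine ⟨⟨fun ⟨m, hm⟩ => ?_, fun hK => ?_⟩, YosidaMin.exists_homeo_yosida_F⟩
  · induction m using Antisymmetrization.ind with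
    | _ A =>
      exact YosidaMin.isZeroDimensional_of_forall_le A fun B =>
        toAntisymmetrization_le_toAntisymmetrization_iff.1 (hm.2 (Set.mem_univ
          (toAntisymmetrization (· ≤ ·) B)))
  · obtain ⟨η, -, h⟩ := YosidaMin.exists_homeo_yosida_F hK
    exact ⟨_, h⟩
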